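/- Let $L$ be a first-order language with equality. A \emph{positive formula} is one built from atomic formulas using $\wedge,\vee,\top,\bot,\exists$; an \emph{h-inductive sentence} is one of the form $\forall x\,(\phi(x)\to\psi(x))$ with $\phi,\psi$ positive; a \emph{positive theory} is a set of h-inductive sentences. A positive formula $\phi(x;y)$ ($x,y$ finite tuples of variables) has $\mathsf{IP}$ in a positive theory $T$ if there are a positive formula $\psi(x;y)$ with $T\models\forall x,y\;\neg(\phi(x;y)\wedge\psi(x;y))$, a model $A\models T$, and tuples $(a_i)_{i\in\omega}$, $(b_W)_{W\subseteq\omega}$ from $A$ such that $A\models\phi(a_i;b_W)$ whenever $i\in W$ and $A\models\psi(a_i;b_W)$ whenever $i\notin W$. The theory $T$ is $\mathsf{NIP}$ if no positive formula has $\mathsf{IP}$ in $T$. For a group $G$, let $L_G=\{<\}\cup\{g\cdot-: g\in G\}$, with $<$ a binary relation symbol and each $g\cdot-$ a unary function symbol, and let $T_G$ be the positive $L_G$-theory of strict linear orders with an action of $G$ by order-automorphisms, axiomatised by: $x<x\to\bot$; $x<y\wedge y<z\to x<z$; $x<y\vee x=y\vee y<x$; $1\cdot x=x$; $(gh)\cdot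 x=g\cdot(h\cdot x)$; and $x<y\to g\cdot x<g\cdot y$ (universally quantified, for all $g,h\in G$). \textbf{Proposition.} For every group $G$, the positive theory $T_G$ is $\mathsf{NIP}$. -/

import Mathlib

universe u v w

namespace PositiveLogic

open FirstOrder FirstOrder.Language

/-! ### Positive formulas, positive theories, and NIP -/

section General

variable {L : FirstOrder.Language.{u, v}}

/-- Positive formulas: built from atomic formulas (equality included) using `⊤`, `⊥`, `∧`, `∨`
and `∃`. -/
inductive IsPositive {α : Type w} : {n : ℕ} → L.BoundedFormula α n → Prop
  | top {n : ℕ} : IsPositive (⊤ : L.BoundedFormula α n)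
  | bot {n : ℕ} : IsPositive (⊥ : L.BoundedFormula α n)
  | atomic {n : ℕ} {φ : L.BoundedFormula α n} : φ.IsAtomic → IsPositive φ
  | inf {n : ℕ} {φ ψ : L.BoundedFormula α n} : IsPositive φ → IsPositive ψ → IsPositive (φ ⊓ ψ)
  | sup {n : ℕ} {φ ψ : L.BoundedFormula α n} : IsPositive φ → IsPositive ψ → IsPositive (φ ⊔ ψ)
  | ex {n : ℕ} {φ : L.BoundedFormula α (n + 1)} : IsPositive φ → IsPositive φ.ex

/-- The sentence `∀ x₀ … xₙ₋₁, (φ → ψ)`. -/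
def allsImp {n : ℕ} (φ ψ : L.BoundedFormula Empty n) : L.Sentence :=
  (φ.imp ψ).alls

/-- An h-inductive sentence: `∀ x (φ(x) → ψ(x))` with `φ`, `ψ` positive and `x` a finite tuple. -/
def IsHInductive (σ : L.Sentence) : Prop :=
  ∃ (n : ℕ) (φ ψ : L.BoundedFormula Empty n), IsPositive φ ∧ IsPositive ψ ∧ σ = allsImp φ ψ

variable (L) in
/-- A positive theory is a set of h-inductive sentences. -/
structure PositiveTheory where
  sentences : L.Theory
  isHInductive : ∀ σ ∈ sentences, IsHInductive σ

/-- The formula `φ(x; y)`, with `|x| = m` and `|y| = n`, has the independence property modulo the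
positive theory `T`: there are a positive `ψ(x; y)` with `T ⊨ ∀ x y, ¬ (φ ∧ ψ)`, a model `A` of
`T` and tuples `(a i)` for `i ∈ ω` and `(b W)` for `W ⊆ ω` in `A` such that `A ⊨ φ(a i; b W)` when
`i ∈ W` and `A ⊨ ψ(a i; b W)` when `i ∉ W`. The model `A` may live in any universe `w`. -/
def HasIP (T : PositiveTheory L) {m n : ℕ} (φ : L.Formula (Fin m ⊕ Fin n)) : Prop :=
  ∃ ψ : L.Formula (Fin m ⊕ Fin n), IsPositive ψ ∧ T.sentences ⊨ᵇ ∼(φ ⊓ ψ) ∧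
    ∃ (A : Type w) (_ : L.Structure A) (_ : A ⊨ T.sentences)
      (a : ℕ → Fin m → A) (b : Set ℕ → Fin n → A), ∀ (i : ℕ) (W : Set ℕ),
        (i ∈ W → φ.Realize (Sum.elim (a i) (b W))) ∧
        (i ∉ W → ψ.Realize (Sum.elim (a i) (b W)))

/-- A positive theory is NIP if no positive formula `φ(x; y)` has the independence property. -/
def IsNIP (T : PositiveTheory L) : Prop :=
  ∀ (m n : ℕ) (φ : L.Formula (Fin m ⊕ Fin n)), IsPositive φ → ¬ HasIP.{u, v, w} T φ

end General

/-! ### Linear orders with an action of a group by automorphisms -/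

/-- One unary function symbol for every element of `G`. -/
inductive ActionFunctions (G : Type u) : ℕ → Type u
  | act (g : G) : ActionFunctions G 1

/-- One binary relation symbol `<`. -/
inductive LtRelations : ℕ → Type
  | lt : LtRelations 2

/-- The language `{<} ∪ {g · - : g ∈ G}`. -/
def orderActionLanguage (G : Type u) : FirstOrder.Language.{u, 0} :=
  ⟨ActionFunctions G, LtRelations⟩

section OrderAction

variable {G : Type u} {α : Type w} {n : ℕ}

/-- The term `g · t`. -/
def actTerm (g : G) (t : (orderActionLanguage G).Term α) : (orderActionLanguage G).Term α :=
  Functions.apply₁ (L := orderActionLanguage G) (ActionFunctions.act g) t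

/-- The atomic formula `s < t`. -/
def ltFormula (s t : (orderActionLanguage G).Term (α ⊕ Fin n)) :
    (orderActionLanguage G).BoundedFormula α n :=
  Relations.boundedFormula₂ (L := orderActionLanguage G) LtRelations.lt s t

lemma isPositive_ltFormula (s t : (orderActionLanguage G).Term (α ⊕ Fin n)) :
    IsPositive (ltFormula s t) :=
  .atomic (.rel _ _)

lemma isPositive_equal (s t : (orderActionLanguage G).Term (α ⊕ Fin n)) :
    IsPositive (s =' t) :=
  .atomic (.equal _ _)

variable (G) in
/-- The axioms of linear orders with an action of `G` by order-automorphisms. -/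
inductive OrderActionAxiom [Group G] : (orderActionLanguage G).Sentence → Prop
  /-- `∀ x, x < x → ⊥` -/
  | irrefl : OrderActionAxiom (allsImp (n := 1) (ltFormula (&0) (&0)) ⊥)
  /-- `∀ x y z, x < y ∧ y < z → x < z` -/
  | trans : OrderActionAxiom
      (allsImp (n := 3) (ltFormula (&0) (&1) ⊓ ltFormula (&1) (&2)) (ltFormula (&0) (&2)))
  /-- `∀ x y, ⊤ → x < y ∨ x = y ∨ y < x` -/
  | total : OrderActionAxiom
      (allsImp (n := 2) ⊤ (ltFormula (&0) (&1) ⊔ ((&0 =' &1) ⊔ ltFormula (&1) (&0))))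
  /-- `∀ x, ⊤ → 1 · x = x` -/
  | one_act : OrderActionAxiom (allsImp (n := 1) ⊤ (actTerm 1 (&0) =' &0))
  /-- `∀ x, ⊤ → (g h) · x = g · (h · x)` -/
  | mul_act (g h : G) : OrderActionAxiom
      (allsImp (n := 1) ⊤ (actTerm (g * h) (&0) =' actTerm g (actTerm h (&0))))
  /-- `∀ x y, x < y → g · x < g · y` -/
  | act_lt (g : G) : OrderActionAxiom
      (allsImp (n := 2) (ltFormula (&0) (&1)) (ltFormula (actTerm g (&0)) (actTerm g (&1))))

end OrderAction

/-- The positive theory of linear orders with an action of `G` by order-automorphisms. -/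
def orderActionTheory (G : Type u) [Group G] : PositiveTheory (orderActionLanguage G) where
  sentences := {σ | OrderActionAxiom G σ}
  isHInductive := by
    rintro σ (_ | _ | _ | _ | ⟨g, h⟩ | g)
    · exact ⟨1, _, _, isPositive_ltFormula _ _, .bot, rfl⟩
    · exact ⟨3, _, _, .inf (isPositive_ltFormula _ _) (isPositive_ltFormula _ _),
        isPositive_ltFormula _ _, rfl⟩
    · exact ⟨2, _, _, .top, .sup (isPositive_ltFormula _ _)
        (.sup (isPositive_equal _ _) (isPositive_ltFormula _ _)), rfl⟩
    · exact ⟨1, _, _, .top, isPositive_equal _ _, rfl⟩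
    · exact ⟨1, _, _, .top, isPositive_equal _ _, rfl⟩
    · exact ⟨2, _, _, isPositive_ltFormula _ _, isPositive_ltFormula _ _, rfl⟩

end PositiveLogic

/-! Two ideas combine. First, models amalgamate over a common family of orbits, and positive
formulas survive homomorphisms. So contradictory positive formulas cannot hold at tuples with the
same order type over all of `G` (`realize_not_of_same_type`). Second, for finitely many group
elements, an infinite sequence of tuples thins to one with constant internal order type and monotone
coordinates. Each comparison with an entry of `b W` then changes at most once. If `W` picks every
other term, some neighbours, one in `W` and one outside, have the same type over `b W`
(`exists_same_type`). An ultraproduct over finite subsets of `G` passes from finitely many group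
elements to all of `G`, contradicting `IP`. -/

namespace PositiveLogic

open FirstOrder FirstOrder.Language Filter

/-! ### Positive formulas and homomorphisms -/

section Preservation

variable {L : FirstOrder.Language.{u, v}} {A B : Type*} [L.Structure A] [L.Structure B]

/-- Positive formulas are preserved by homomorphisms. -/
theorem IsPositive.realize_hom {α : Type*} {n : ℕ} {φ : L.BoundedFormula α n} (hφ : IsPositive φ)
    (f : A →[L] B) {v : α → A} {xs : Fin n → A} (h : φ.Realize v xs) :
    φ.Realize (f ∘ v) (f ∘ xs) := by
  induction hφ with
  | top => exact BoundedFormula.realize_top.2 trivial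
  | bot => exact h.elim
  | atomic hat =>
    cases hat with
    | equal t₁ t₂ =>
      simp only [BoundedFormula.realize_bdEqual, ← Sum.comp_elim, HomClass.realize_term] at h ⊢
      rw [h]
    | rel R ts =>
      simp only [BoundedFormula.realize_rel, ← Sum.comp_elim, HomClass.realize_term] at h ⊢
      exact f.map_rel R _ h
  | inf _ _ ih₁ ih₂ =>
    rw [BoundedFormula.realize_inf] at h ⊢
    exact ⟨ih₁ h.1, ih₂ h.2⟩
  | sup _ _ ih₁ ih₂ =>
    rw [BoundedFormula.realize_sup] at h ⊢
    exact h.imp ih₁ ih₂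
  | ex _ ih =>
    rw [BoundedFormula.realize_ex] at h ⊢
    obtain ⟨a, ha⟩ := h
    refine ⟨f a, ?_⟩
    rw [← Fin.comp_snoc]
    exact ih ha

theorem IsPositive.realize_formula_hom {α : Type*} {φ : L.Formula α} (hφ : IsPositive φ)
    (f : A →[L] B) {v : α → A} (h : φ.Realize v) : φ.Realize (f ∘ v) := by
  have := hφ.realize_hom f h
  rwa [Subsingleton.elim (f ∘ default) default] at this

theorem realize_allsImp {n : ℕ} {φ ψ : L.BoundedFormula Empty n} :
    A ⊨ allsImp φ ψ ↔ ∀ xs : Fin n → A, φ.Realize default xs → ψ.Realize default xs :=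
  BoundedFormula.realize_alls

end Preservation

/-! ### Models as linear orders with a group action -/

section Structures

variable {G : Type u}

/-- The atomic relation `x < y` in a structure. -/
def StructureLt (G : Type u) {A : Type*} [(orderActionLanguage G).Structure A] (x y : A) : Prop :=
  Structure.RelMap (L := orderActionLanguage G) LtRelations.lt ![x, y]

/-- The action of `g` on a structure. -/
def structureAct {A : Type*} [(orderActionLanguage G).Structure A] (g : G) (x : A) : A :=
  Structure.funMap (L := orderActionLanguage G) (ActionFunctions.act g) ![x]

section Realize

variable {A : Type*} [(orderActionLanguage G).Structure A] {α : Type*} {n : ℕ}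

@[simp]
theorem realize_actTerm (g : G) (t : (orderActionLanguage G).Term α) (v : α → A) :
    (actTerm g t).realize v = structureAct g (t.realize v) :=
  Term.realize_functions_apply₁

@[simp]
theorem realize_ltFormula (s t : (orderActionLanguage G).Term (α ⊕ Fin n)) (v : α → A)
    (xs : Fin n → A) :
    (ltFormula s t).Realize v xs ↔
      StructureLt G (s.realize (Sum.elim v xs)) (t.realize (Sum.elim v xs)) :=
  BoundedFormula.realize_rel₂

end Realize

/-- A structure is a model of `orderActionTheory G` iff `<` is a strict linear order on which `G`
acts by order-automorphisms. -/
theorem model_orderActionTheory_iff [Group G] {A : Type*} [(orderActionLanguage G).Structure A] :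
    A ⊨ (orderActionTheory G).sentences ↔
      (∀ x : A, ¬ StructureLt G x x) ∧
      (∀ x y z : A, StructureLt G x y → StructureLt G y z → StructureLt G x z) ∧
      (∀ x y : A, StructureLt G x y ∨ x = y ∨ StructureLt G y x) ∧
      (∀ x : A, structureAct (1 : G) x = x) ∧
      (∀ (g h : G) (x : A), structureAct (g * h) x = structureAct g (structureAct h x)) ∧
      (∀ (g : G) (x y : A), StructureLt G x y →
        StructureLt G (structureAct g x) (structureAct g y)) := by
  rw [Theory.model_iff]
  constructor
  · intro h
    refine ⟨fun x => ?_, fun x y z => ?_, fun x y => ?_, fun x => ?_, fun g k x => ?_,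
      fun g x y => ?_⟩
    · simpa using realize_allsImp.1 (h _ OrderActionAxiom.irrefl) ![x]
    · simpa using realize_allsImp.1 (h _ OrderActionAxiom.trans) ![x, y, z]
    · simpa using realize_allsImp.1 (h _ OrderActionAxiom.total) ![x, y]
    · simpa using realize_allsImp.1 (h _ OrderActionAxiom.one_act) ![x]
    · simpa using realize_allsImp.1 (h _ (OrderActionAxiom.mul_act g k)) ![x]
    · simpa using realize_allsImp.1 (h _ (OrderActionAxiom.act_lt g)) ![x, y]
  · rintro ⟨h₁, h₂, h₃, h₄, h₅, h₆⟩ σ (_ | _ | _ | _ | ⟨g, k⟩ | g) <;>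
      refine realize_allsImp.2 fun xs => ?_
    · simpa using h₁ (xs 0)
    · simpa using h₂ (xs 0) (xs 1) (xs 2)
    · simpa using h₃ (xs 0) (xs 1)
    · simpa using h₄ (xs 0)
    · simpa using h₅ g k (xs 0)
    · simpa using h₆ g (xs 0) (xs 1)

section Models

variable [Group G] {A : Type*} [(orderActionLanguage G).Structure A]

open Classical in
/-- The linear order of a model. -/
noncomputable abbrev modelLinearOrder (hA : A ⊨ (orderActionTheory G).sentences) :
    LinearOrder A :=
  have h := model_orderActionTheory_iff.1 hA
  { le := fun x y => x = y ∨ StructureLt G x y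
    lt := StructureLt G
    le_refl := fun _ => .inl rfl
    le_trans := by
      rintro x y z (rfl | hxy) (rfl | hyz)
      exacts [.inl rfl, .inr hyz, .inr hxy, .inr (h.2.1 _ _ _ hxy hyz)]
    le_antisymm := by
      rintro x y (rfl | hxy) (hyx | hyx)
      exacts [rfl, rfl, hyx.symm, (h.1 _ (h.2.1 _ _ _ hxy hyx)).elim]
    lt_iff_le_not_ge := fun x y => by
      refine ⟨fun hxy => ⟨.inr hxy, ?_⟩, fun ⟨hxy, hyx⟩ => ?_⟩
      · rintro (rfl | hyx)
        exacts [h.1 _ hxy, h.1 _ (h.2.1 _ _ _ hxy hyx)]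
      · rcases hxy with rfl | hxy
        exacts [(hyx (.inl rfl)).elim, hxy]
    le_total := fun x y => by
      rcases h.2.2.1 x y with hxy | rfl | hyx
      exacts [.inl (.inr hxy), .inl (.inl rfl), .inr (.inr hyx)]
    toDecidableLE := Classical.decRel _ }

/-- The group action on a model. -/
abbrev modelMulAction (hA : A ⊨ (orderActionTheory G).sentences) : MulAction G A :=
  have h := model_orderActionTheory_iff.1 hA
  { smul := structureAct
    one_smul := h.2.2.2.1
    mul_smul := h.2.2.2.2.1 }

end Models

/-- The structure carried by an ordered set with an action of `G`. -/
abbrev orderActionStructure (G : Type u) (A : Type*) [LT A] [SMul G A] :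
    (orderActionLanguage G).Structure A where
  funMap | .act g => fun x => g • x 0
  RelMap | .lt => fun x => x 0 < x 1

theorem orderActionStructure_model [Group G] (A : Type*) [LinearOrder A] [MulAction G A]
    (hA : ∀ g : G, StrictMono fun x : A => g • x) :
    letI := orderActionStructure G A
    A ⊨ (orderActionTheory G).sentences :=
  letI := orderActionStructure G A
  model_orderActionTheory_iff.2 ⟨fun _ => lt_irrefl _, fun _ _ _ => lt_trans, lt_trichotomy,
    one_smul G, mul_smul, fun g _ _ h => hA g h⟩

/-- A strictly monotone equivariant map is a homomorphism. -/
def orderActionHom {A B : Type*} [(orderActionLanguage G).Structure A]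
    [(orderActionLanguage G).Structure B] (f : A → B)
    (hlt : ∀ x y, StructureLt G x y → StructureLt G (f x) (f y))
    (hact : ∀ (g : G) x, f (structureAct g x) = structureAct g (f x)) :
    A →[orderActionLanguage G] B where
  toFun := f
  map_fun' := by
    rintro _ ⟨g⟩ x
    have := hact g (x 0)
    unfold structureAct at this
    convert this using 3 <;> exact List.ofFn_inj.1 rfl
  map_rel' := by
    rintro _ ⟨⟩ x h
    have := hlt (x 0) (x 1)
    unfold StructureLt at this
    convert this ?_ using 2
    · exact List.ofFn_inj.1 rfl
    · convert h using 2
      exact List.ofFn_inj.1 rfl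

end Structures

/-! ### Amalgamation over a common family of points -/

section Amalgamation

universe uB uC

variable {B : Type uB} {C : Type uC} {J : Type*} [LinearOrder B] [LinearOrder C]

/-- The sum of two linear orders, to be glued along `e j ∼ e' j`. -/
def Glue (_ : J → B) (_ : J → C) : Type (max uB uC) := B ⊕ C

namespace Glue

variable {e : J → B} {e' : J → C}

/-- The gluing preorder. -/
def le : Glue e e' → Glue e e' → Prop
  | .inl b, .inl b' => b ≤ b'
  | .inr c, .inr c' => c ≤ c'
  -- A pair whose order no `j` decides gets `b` below `c`. Both inequalities hold only if some `j`
  -- has `e j = b` and `e' j = c`, so no other points are identified.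
  | .inl b, .inr c => ∀ j, (e j ≤ b → e' j ≤ c) ∧ (e j < b → e' j < c)
  | .inr c, .inl b => ∃ j, c ≤ e' j ∧ e j ≤ b

instance : Preorder (Glue e e') where
  le := le
  le_refl := by rintro (b | c) <;> exact le_refl _
  le_trans := by
    rintro (x | x) (y | y) (z | z) hxy hyz
    · exact le_trans (α := B) hxy hyz
    · exact fun j => ⟨fun h => (hyz j).1 (h.trans hxy), fun h => (hyz j).2 (h.trans_le hxy)⟩
    · obtain ⟨j, h₁, h₂⟩ := hyz
      by_contra hzx
      exact (((hxy j).2 (h₂.trans_lt (not_le.1 hzx))).trans_le h₁).false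
    · exact fun j => ⟨fun h => ((hxy j).1 h).trans hyz, fun h => ((hxy j).2 h).trans_le hyz⟩
    · obtain ⟨j, h₁, h₂⟩ := hxy
      exact ⟨j, h₁, h₂.trans hyz⟩
    · obtain ⟨j, h₁, h₂⟩ := hxy
      exact h₁.trans ((hyz j).1 h₂)
    · obtain ⟨j, h₁, h₂⟩ := hyz
      exact ⟨j, le_trans (α := C) hxy h₁, h₂⟩
    · exact le_trans (α := C) hxy hyz

instance : Std.Total (α := Glue e e') (· ≤ ·) where
  total := by
    have key (b : B) (c : C) : le (e := e) (e' := e') (.inl b) (.inr c) ∨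
        le (e := e) (e' := e') (.inr c) (.inl b) := by
      by_contra! h
      refine h.1 fun j => ?_
      have hj : e j ≤ b → e' j < c := fun hb => not_le.1 fun hc => h.2 ⟨j, hc, hb⟩
      exact ⟨fun hb => (hj hb).le, fun hb => hj hb.le⟩
    rintro (b | c) (b' | c')
    exacts [le_total b b', key b c', (key b' c).symm, le_total c c']

variable {G : Type*} [Group G] [MulAction G B] [MulAction G C]

instance : MulAction G (Glue e e') := inferInstanceAs (MulAction G (B ⊕ C))

theorem smul_le_smul [MulAction G J] (hB : ∀ g : G, StrictMono fun x : B => g • x)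
    (hC : ∀ g : G, StrictMono fun x : C => g • x) (he : ∀ (g : G) j, e (g • j) = g • e j)
    (he' : ∀ (g : G) j, e' (g • j) = g • e' j) (g : G) {x y : Glue e e'} (h : x ≤ y) :
    g • x ≤ g • y := by
  rcases x with x | x <;> rcases y with y | y
  · exact (hB g).monotone h
  · intro j
    -- The condition at `j` for the translated pair is the condition at `g⁻¹ • j` for the original
    -- pair.
    have hj := h (g⁻¹ • j)
    rw [he, he'] at hj
    rw [← (hB g⁻¹).le_iff_le, ← (hB g⁻¹).lt_iff_lt, ← (hC g⁻¹).le_iff_le, ← (hC g⁻¹).lt_iff_lt]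
    simpa only [inv_smul_smul] using hj
  · obtain ⟨j, h₁, h₂⟩ := h
    exact ⟨g • j, by simpa only [he'] using (hC g).monotone h₁,
      by simpa only [he] using (hB g).monotone h₂⟩
  · exact (hC g).monotone h

end Glue

open Classical in
/-- Linear orders with a group action can be amalgamated over a common suborder. -/
theorem exists_amalgam {G : Type*} [Group G] [MulAction G B] [MulAction G C] [MulAction G J]
    (hB : ∀ g : G, StrictMono fun x : B => g • x)
    (hC : ∀ g : G, StrictMono fun x : C => g • x) (e : J → B) (e' : J → C)
    (he : ∀ (g : G) j, e (g • j) = g • e j) (he' : ∀ (g : G) j, e' (g • j) = g • e' j)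
    (hee : ∀ j k, e j < e k ↔ e' j < e' k) :
    ∃ (D : Type (max uB uC)) (_ : LinearOrder D) (_ : MulAction G D) (f : B → D) (f' : C → D),
      (∀ g : G, StrictMono fun x : D => g • x) ∧ StrictMono f ∧ StrictMono f' ∧
      (∀ (g : G) x, f (g • x) = g • f x) ∧ (∀ (g : G) x, f' (g • x) = g • f' x) ∧
      ∀ j, f (e j) = f' (e' j) := by
  have hle (g : G) {x y : Glue e e'} : x ≤ y → g • x ≤ g • y :=
    Glue.smul_le_smul hB hC he he' g
  have hlt (g : G) {x y : Glue e e'} (h : x < y) : g • x < g • y := by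
    rw [lt_iff_le_not_ge] at h ⊢
    exact ⟨hle g h.1, fun h' => h.2 (by simpa only [inv_smul_smul] using hle g⁻¹ h')⟩
  let act : MulAction G (Antisymmetrization (Glue e e') (· ≤ ·)) :=
    { smul := fun g => Quotient.map (g • ·) fun _ _ h => ⟨hle g h.1, hle g h.2⟩
      one_smul := by
        rintro ⟨x⟩
        exact congrArg (toAntisymmetrization _) (one_smul G x)
      mul_smul := by
        rintro g h ⟨x⟩
        exact congrArg (toAntisymmetrization _) (mul_smul g h x) }
  refine ⟨Antisymmetrization (Glue e e') (· ≤ ·), inferInstance, act,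
    fun b => toAntisymmetrization _ (Sum.inl b : Glue e e'),
    fun c => toAntisymmetrization _ (Sum.inr c : Glue e e'),
    ?_, fun x y h => ?_, fun x y h => ?_, fun _ _ => rfl, fun _ _ => rfl, fun j => ?_⟩
  · rintro g ⟨x⟩ ⟨y⟩ h
    exact hlt g h
  · exact lt_iff_le_not_ge.2 (lt_iff_le_not_ge (α := B).1 h)
  · exact lt_iff_le_not_ge.2 (lt_iff_le_not_ge (α := C).1 h)
  -- The index `j` itself witnesses `e' j ≤ e j`; the reverse inequality is the agreement `hee` of
  -- the two orders on `J`.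
  · refine Quotient.sound ⟨fun k => ⟨fun h => ?_, (hee k j).1⟩, j, le_rfl, le_rfl⟩
    exact not_lt.1 fun h' => not_lt.2 h ((hee j k).2 h')

end Amalgamation

/-! ### Thinning sequences and alternation -/

section Indiscernibles

/-- Ramsey's theorem is applied one coordinate at a time; passing to a further subsequence keeps the
monotonicity already gained. -/
theorem exists_subseq_monotone_or_antitone {A ι : Type*} [LinearOrder A] [Finite ι]
    (a : ℕ → ι → A) :
    ∃ s : ℕ ↪o ℕ, ∀ j, Monotone (fun n => a (s n) j) ∨ Antitone (fun n => a (s n) j) := by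
  classical
  have := Fintype.ofFinite ι
  suffices ∀ t : Finset ι, ∃ s : ℕ ↪o ℕ, ∀ j ∈ t,
      Monotone (fun n => a (s n) j) ∨ Antitone (fun n => a (s n) j) by
    obtain ⟨s, hs⟩ := this Finset.univ
    exact ⟨s, fun j => hs j (Finset.mem_univ j)⟩
  intro t
  induction t using Finset.induction_on with
  | empty => exact ⟨RelEmbedding.refl _, by simp⟩
  | insert i t _ ih =>
    obtain ⟨s, hs⟩ := ih
    obtain ⟨r, hr⟩ := exists_increasing_or_nonincreasing_subseq (· ≤ ·) fun n => a (s n) i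
    refine ⟨r.trans s, fun j hj => ?_⟩
    obtain rfl | hj := Finset.mem_insert.1 hj
    · refine hr.imp (fun h => ?_) (fun h => ?_)
      · exact monotone_iff_forall_lt.2 fun m n hmn => h m n hmn
      · exact antitone_iff_forall_lt.2 fun m n hmn => (not_le.1 (h m n hmn)).le
    · exact (hs j hj).imp (fun h => h.comp r.monotone) (fun h => h.comp_monotone r.monotone)

theorem exists_subseq_const {K : Type*} [Finite K] (c : ℕ → K) :
    ∃ s : ℕ ↪o ℕ, ∀ m n, c (s m) = c (s n) := by
  classical
  obtain ⟨y, hy⟩ := Finite.exists_infinite_fiber c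
  refine ⟨Nat.orderEmbeddingOfSet (c ⁻¹' {y}), fun m n => ?_⟩
  have h (n) : c (Nat.orderEmbeddingOfSet (c ⁻¹' {y}) n) = y := by
    rw [Nat.coe_orderEmbeddingOfSet]
    exact (Nat.Subtype.ofNat (c ⁻¹' {y}) n).2
  rw [h, h]

/-- Such a predicate changes truth value at most once. -/
theorem eventually_iff_succ_of_monotone {p : ℕ → Prop} (hp : Monotone p ∨ Antitone p) :
    ∀ᶠ n in atTop, (p n ↔ p (n + 1)) := by
  rcases hp with hp | hp
  · by_cases h : ∃ n, p n
    · obtain ⟨N, hN⟩ := h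
      filter_upwards [eventually_ge_atTop N] with n hn
      exact iff_of_true (hp hn hN) (hp (hn.trans n.le_succ) hN)
    · push Not at h
      simp [h]
  · by_cases h : ∃ n, ¬ p n
    · obtain ⟨N, hN⟩ := h
      filter_upwards [eventually_ge_atTop N] with n hn
      exact iff_of_false (fun h => hN (hp hn h)) (fun h => hN (hp (hn.trans n.le_succ) h))
    · push Not at h
      simp [h]

theorem eventually_lt_const_iff_succ {A : Type*} [LinearOrder A] {f : ℕ → A}
    (hf : Monotone f ∨ Antitone f) (c : A) :
    ∀ᶠ n in atTop, (f n < c ↔ f (n + 1) < c) :=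
  eventually_iff_succ_of_monotone <| hf.symm.imp (fun h _ _ hmn h' => (h hmn).trans_lt h')
    (fun h _ _ hmn h' => (h hmn).trans_lt h')

theorem eventually_const_lt_iff_succ {A : Type*} [LinearOrder A] {f : ℕ → A}
    (hf : Monotone f ∨ Antitone f) (c : A) :
    ∀ᶠ n in atTop, (c < f n ↔ c < f (n + 1)) :=
  eventually_iff_succ_of_monotone <| hf.imp (fun h _ _ hmn h' => lt_of_lt_of_le h' (h hmn))
    (fun h _ _ hmn h' => lt_of_lt_of_le h' (h hmn))

/-- For finitely many group elements, some `a i` with `i ∈ W` and some `a i'` with `i' ∉ W` have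
the same order type over `b W`. -/
theorem exists_same_type {G A ι κ : Type*} [Group G] [LinearOrder A] [MulAction G A]
    (hA : ∀ g : G, StrictMono fun x : A => g • x) [Finite ι] [Finite κ]
    (a : ℕ → ι → A) (b : Set ℕ → κ → A) (F : Finset G) :
    ∃ (i i' : ℕ) (W : Set ℕ), i ∈ W ∧ i' ∉ W ∧ ∀ g ∈ F, ∀ h ∈ F, ∀ p q : ι ⊕ κ,
      (g • Sum.elim (a i) (b W) p < h • Sum.elim (a i) (b W) q ↔
        g • Sum.elim (a i') (b W) p < h • Sum.elim (a i') (b W) q) := by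
  -- The colour of `i` is the internal order type of `a i` over `F`, one of finitely many.
  obtain ⟨r, hr⟩ := exists_subseq_const
    fun (i : ℕ) (j k : ι) (g h : F) => (g : G) • a i j < (h : G) • a i k
  obtain ⟨t, ht⟩ := exists_subseq_monotone_or_antitone fun n => a (r n)
  have hs : Function.Injective fun n => r (t n) := r.injective.comp t.injective
  have hmono (g : G) (j : ι) :
      Monotone (fun n => g • a (r (t n)) j) ∨ Antitone (fun n => g • a (r (t n)) j) :=
    (ht j).imp (hA g).monotone.comp (hA g).monotone.comp_antitone
  -- The thinning did not involve `b`, so `W` can be chosen after it: membership flips at every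
  -- step, while the type over `b W` is eventually constant.
  let W : Set ℕ := Set.range fun n => r (t (2 * n))
  have key : ∀ᶠ n in atTop, ∀ (g h : F) (p q : ι ⊕ κ),
      ((g : G) • Sum.elim (a (r (t n))) (b W) p < (h : G) • Sum.elim (a (r (t n))) (b W) q ↔
        (g : G) • Sum.elim (a (r (t (n + 1)))) (b W) p <
          (h : G) • Sum.elim (a (r (t (n + 1)))) (b W) q) := by
    simp only [eventually_all]
    rintro g h (j | k) (j' | k')
    · refine Eventually.of_forall fun n => ?_
      exact iff_of_eq (congrFun (congrFun (congrFun (congrFun (hr (t n) (t (n + 1))) j) j') g) h)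
    · exact eventually_lt_const_iff_succ (hmono g j) ((h : G) • b W k')
    · exact eventually_const_lt_iff_succ (hmono h j') ((g : G) • b W k)
    · exact Eventually.of_forall fun n => Iff.rfl
  obtain ⟨N, hN⟩ := eventually_atTop.1 key
  refine ⟨r (t (2 * N)), r (t (2 * N + 1)), W, ⟨N, rfl⟩, ?_, fun g hg h hh p q => ?_⟩
  · rintro ⟨n, hn⟩
    have := hs hn
    lia
  · exact hN (2 * N) (by lia) ⟨g, hg⟩ ⟨h, hh⟩ p q

end Indiscernibles

/-! ### Compatibility of positive formulas -/

section Nip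

variable {G : Type u} [Group G]

/-- If tuples of two models have the same quantifier-free type, then positive formulas satisfied
by them hold simultaneously in some model. -/
theorem realize_not_of_same_type {β : Type*} {φ ψ : (orderActionLanguage G).Formula β}
    (hφ : IsPositive φ) (hψ : IsPositive ψ)
    (hφψ : (orderActionTheory G).sentences ⊨ᵇ ∼(φ ⊓ ψ)) {B C : Type*}
    [Nonempty B] [(orderActionLanguage G).Structure B] [(orderActionLanguage G).Structure C]
    (hB : B ⊨ (orderActionTheory G).sentences) (hC : C ⊨ (orderActionTheory G).sentences)
    {v : β → B} {v' : β → C}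
    (hvv : ∀ (g h : G) p q, StructureLt G (structureAct g (v p)) (structureAct h (v q)) ↔
      StructureLt G (structureAct g (v' p)) (structureAct h (v' q)))
    (hv : φ.Realize v) : ¬ ψ.Realize v' := by
  intro hv'
  have hB' := model_orderActionTheory_iff.1 hB
  have hC' := model_orderActionTheory_iff.1 hC
  let := modelLinearOrder hB
  let := modelLinearOrder hC
  let := modelMulAction hB
  let := modelMulAction hC
  -- Formal translates of the variables index the orbits to be glued; the maps to `B` and `C` need
  -- not be injective.
  let : MulAction G (G × β) :=
    { smul := fun g j => (g * j.1, j.2)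
      one_smul := fun j => Prod.ext (one_mul _) rfl
      mul_smul := fun g h j => Prod.ext (mul_assoc _ _ _) rfl }
  obtain ⟨D, _, _, f, f', hD, hf, hf', hfG, hfG', hff⟩ := exists_amalgam (G := G)
    (fun g _ _ h => hB'.2.2.2.2.2 g _ _ h) (fun g _ _ h => hC'.2.2.2.2.2 g _ _ h)
    (fun j : G × β => j.1 • v j.2) (fun j : G × β => j.1 • v' j.2)
    (fun g j => mul_smul g j.1 (v j.2)) (fun g j => mul_smul g j.1 (v' j.2))
    (fun j k => hvv j.1 k.1 j.2 k.2)
  let := orderActionStructure G D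
  have := orderActionStructure_model (G := G) D hD
  have h₁ := hφ.realize_formula_hom (orderActionHom f (fun _ _ h => hf h) hfG) hv
  have h₂ := hψ.realize_formula_hom (orderActionHom f' (fun _ _ h => hf' h) hfG') hv'
  have hv'' : f ∘ v = f' ∘ v' := funext fun p => by
    have := hff (1, p)
    simp only [one_smul] at this
    exact this
  have : Nonempty D := ‹Nonempty B›.map f
  have := hφψ.realize_formula D (v := f ∘ v)
  rw [Formula.realize_not, Formula.realize_inf] at this
  refine this ⟨h₁, ?_⟩
  rw [hv'']
  exact h₂

/-- Contradictory positive formulas cannot hold simultaneously in a model, even an empty one. -/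
theorem nonempty_of_realize {β : Type*} {φ ψ : (orderActionLanguage G).Formula β}
    (hφ : IsPositive φ) (hψ : IsPositive ψ)
    (hφψ : (orderActionTheory G).sentences ⊨ᵇ ∼(φ ⊓ ψ)) {A : Type*}
    [(orderActionLanguage G).Structure A] {v v' : β → A} (hv : φ.Realize v)
    (hv' : ψ.Realize v') : Nonempty A := by
  by_contra hA
  have : IsEmpty A := not_nonempty_iff.1 hA
  -- `⊨ᵇ` speaks only of nonempty models, so the empty structure is mapped to the one-point model.
  let := orderActionStructure G PUnit.{1}
  have := orderActionStructure_model (G := G) PUnit.{1} fun g x y h => (lt_irrefl _ h).elim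
  let f : A →[orderActionLanguage G] PUnit.{1} :=
    orderActionHom isEmptyElim (fun x => isEmptyElim x) (fun _ x => isEmptyElim x)
  have h₁ := hφ.realize_formula_hom f hv
  have h₂ := hψ.realize_formula_hom f hv'
  have := hφψ.realize_formula PUnit.{1} (v := f ∘ v)
  rw [Formula.realize_not, Formula.realize_inf] at this
  exact this ⟨h₁, h₂⟩

/-- Two sequences of tuples realizing `φ` and `ψ` whose order types agree over larger and larger
finite sets of group elements have a common limit, so `φ` and `ψ` are compatible. -/
theorem false_of_same_type_finset {β : Type*} {φ ψ : (orderActionLanguage G).Formula β}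
    (hφ : IsPositive φ) (hψ : IsPositive ψ)
    (hφψ : (orderActionTheory G).sentences ⊨ᵇ ∼(φ ⊓ ψ)) {A : Type*} [Nonempty A]
    [(orderActionLanguage G).Structure A] (hA : A ⊨ (orderActionTheory G).sentences)
    {v v' : Finset G → β → A} (hv : ∀ F, φ.Realize (v F)) (hv' : ∀ F, ψ.Realize (v' F))
    (hvv : ∀ F, ∀ g ∈ F, ∀ h ∈ F, ∀ p q,
      (StructureLt G (structureAct g (v F p)) (structureAct h (v F q)) ↔
        StructureLt G (structureAct g (v' F p)) (structureAct h (v' F q)))) : False := by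
  classical
  -- Refining `atTop` puts every cone `{F | {g, h} ⊆ F}` in `U`, so each comparison of a `g`- and an
  -- `h`-translate agrees almost everywhere.
  let U : Ultrafilter (Finset G) := Ultrafilter.of atTop
  let P := (U : Filter (Finset G)).Product fun _ => A
  let x (w : Finset G → β → A) : β → P :=
    fun p => ((fun F => w F p : Finset G → A) : (U : Filter (Finset G)).Product fun _ => A)
  have hP : P ⊨ (orderActionTheory G).sentences := by
    rw [Theory.model_iff] at hA ⊢
    exact fun σ hσ => (Ultraproduct.sentence_realize σ).2 (Eventually.of_forall fun _ => hA σ hσ)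
  have hlt (w : Finset G → β → A) (g h : G) (p q : β) :
      StructureLt G (structureAct g (x w p)) (structureAct h (x w q)) ↔
        ∀ᶠ F in U, StructureLt G (structureAct g (w F p)) (structureAct h (w F q)) := by
    have := Ultraproduct.realize_formula_cast (u := U)
      (ltFormula (n := 0) (actTerm g (Term.var (Sum.inl p))) (actTerm h (Term.var (Sum.inl q))))
      (fun p F => w F p)
    simp only [Formula.Realize, realize_ltFormula, realize_actTerm, Term.realize_var,
      Sum.elim_inl] at this
    exact this
  refine realize_not_of_same_type hφ hψ hφψ (B := P) (C := P) hP hP (v := x v) (v' := x v')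
    (fun g h p q => ?_) ?_ ?_
  · rw [hlt, hlt]
    refine eventually_congr ?_
    have : ∀ᶠ F : Finset G in U, {g, h} ⊆ F :=
      Ultrafilter.of_le atTop (eventually_ge_atTop ({g, h} : Finset G))
    filter_upwards [this] with F hF
    exact hvv F g (hF (by simp)) h (hF (by simp)) p q
  · exact (Ultraproduct.realize_formula_cast φ _).2 (Eventually.of_forall hv)
  · exact (Ultraproduct.realize_formula_cast ψ _).2 (Eventually.of_forall hv')

end Nip

end PositiveLogic

theorem mainTheorem3 (G : Type u) [Group G] :
    PositiveLogic.IsNIP.{u, 0, w} (PositiveLogic.orderActionTheory G) := by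
  open PositiveLogic in
  rintro m n φ hφ ⟨ψ, hψ, hφψ, A, _, hA, a, b, hab⟩
  have hA' := model_orderActionTheory_iff.1 hA
  have : Nonempty A := nonempty_of_realize hφ hψ hφψ ((hab 0 Set.univ).1 trivial)
    ((hab 0 ∅).2 (Set.notMem_empty 0))
  let := modelLinearOrder hA
  let := modelMulAction hA
  -- The indices and `W` depend on the finite set `F`; only the resulting tuples enter the
  -- ultraproduct.
  choose i i' W hi hi' htype using
    exists_same_type (G := G) (fun g _ _ h => hA'.2.2.2.2.2 g _ _ h) a b
  exact false_of_same_type_finset hφ hψ hφψ hA (fun F => (hab (i F) (W F)).1 (hi F))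
    (fun F => (hab (i' F) (W F)).2 (hi' F)) htype
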